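/- Let $\mathbb T=\mathbb R/2\pi\mathbb Z$, let $C(\mathbb T)$ be the space of continuous complex-valued functions on $\mathbb T$ with the norm $\|f\|_{C(\mathbb T)}=\sup_{t\in\mathbb T}|f(t)|$, and for $f\in C(\mathbb T)$ let $\widehat f(k)=\frac1{2\pi}\int_0^{2\pi}f(t)e^{-ikt}\,dt$ $(k\in\mathbb Z)$ and $S_N(f)(t)=\sum_{|k|\le N}\widehat f(k)e^{ikt}$. Let $U(\mathbb T)$ be the set of all $f\in C(\mathbb T)$ whose Fourier series converges uniformly, i.e. $\|f-S_N(f)\|_{C(\mathbb T)}\to0$ as $N\to\infty$, and let $MU(\mathbb T)$ be the set of all $m\in C(\mathbb T)$ such that $mf\in U(\mathbb T)$ for every $f\in U(\mathbb T)$. Let $\gamma=\{\gamma(n)\}_{n=0}^{\infty}$ be a sequence of positive real numbers that is bounded away from zero, i.e. $\inf_n\gamma(n)>0$, and let $A_\gamma(\mathbb T)$ be the set of all $f\in C(\mathbb T)$ with $\sum_{k\in\mathbb Z}|\widehat f(k)|\,\gamma(|k|)<\infty$. Then $$A_\gamma(\mathbb T)\subseteq MU(\mathbb T)\quad\text{if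 and only if}\quad\liminf_{n\to\infty}\frac{\gamma(n)}{\log n}>0,$$ where the lower limit is taken in $[0,+\infty]$. -/

import Mathlib

open Filter Topology

namespace UnifFourier

/-- The period `2π` is positive (needed for integration over the circle). -/
instance fact_two_pi_pos : Fact (0 < 2 * Real.pi) := ⟨Real.two_pi_pos⟩

/-- The circle `𝕋 = ℝ / 2πℤ`. -/
abbrev Circ : Type := AddCircle (2 * Real.pi)

/-- The symmetric partial sum `S_N(f)(t) = ∑_{|k| ≤ N} f̂(k) e^{ikt}` of the Fourier series of `f`.
Here `fourier k` is the function `t ↦ e^{ikt}` on the circle of length `2π`, and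
`fourierCoeff f k` is `(1/2π) ∫ f(t) e^{-ikt} dt`. -/
noncomputable def partialSum (N : ℕ) (f : C(Circ, ℂ)) : C(Circ, ℂ) :=
  ∑ k ∈ Finset.Icc (-(N : ℤ)) (N : ℤ), fourierCoeff f k • fourier k

/-- `U(𝕋)`: the continuous functions whose Fourier series converges uniformly, that is
`‖f - S_N(f)‖ → 0` in the supremum norm. -/
def U : Set C(Circ, ℂ) :=
  {f | Tendsto (fun N : ℕ => ‖f - partialSum N f‖) atTop (𝓝 0)}

/-- `MU(𝕋)`: the pointwise multipliers of `U(𝕋)`. -/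
def MU : Set C(Circ, ℂ) :=
  {m | ∀ f ∈ U, m * f ∈ U}

/-- `A_γ(𝕋)`: the continuous functions with `∑_{k ∈ ℤ} |f̂(k)| γ(|k|) < ∞`. -/
def A (γ : ℕ → ℝ) : Set C(Circ, ℂ) :=
  {f | Summable fun k : ℤ => ‖fourierCoeff f k‖ * γ k.natAbs}

end UnifFourier

namespace UnifFourier

open MeasureTheory AddCircle

/-! ### Fourier coefficients and partial sums as continuous linear maps -/

/-! Write e_n for `fourier n`. Sufficiency: multiplication by e_n translates the frequency window of
S_N by n, so S_N(e_n f) is e_n times S_N(f) corrected by two blocks of length |n|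
(`exists_partialSum_fourier_mul_eq`). A block costs O(1 + log(|n| + 1))‖f‖ uniformly in its position
(`norm_block_le`), since its kernel is a modulated Dirichlet kernel. Summing m̂(n) e_n f with this
bound, independent of N, dominated convergence gives mf ∈ U.

Necessity: the sawtooth sums s_l = `sineSum l` are uniformly bounded, but cutting e_n s_n at
frequency n keeps only one half of its spectrum, so -Re S_n(e_n s_n)(0) is a harmonic sum ≥ log n.
If the lower limit is not positive, choose φ with γ(φ j) ≤ 8⁻ʲ log φ j and set m = ∑ 2⁻ʲ γ(φ j)⁻¹
e_{φ j}, f = ∑ 2⁻ʲ s_{φ j}. All cross terms have the same sign, so the diagonal term alone makes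
S_{φ j}(mf)(0) at least 2ʲ in modulus, and mf ∉ U. The explicit f replaces a uniform boundedness
argument. -/

theorem norm_fourier_apply (k : ℤ) (t : Circ) : ‖fourier k t‖ = 1 := Circle.norm_coe _

theorem integrable_haar (f : C(Circ, ℂ)) : Integrable f (haarAddCircle (T := 2 * Real.pi)) :=
  f.continuous.integrable_of_hasCompactSupport (HasCompactSupport.of_compactSpace f)

theorem norm_fourierCoeff_le (f : C(Circ, ℂ)) (k : ℤ) : ‖fourierCoeff f k‖ ≤ ‖f‖ := by
  have h := norm_integral_le_of_norm_le_const (μ := haarAddCircle (T := 2 * Real.pi))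
    (f := fun t => fourier (-k) t • f t) (C := ‖f‖) (ae_of_all _ fun t => by
      rw [norm_smul, norm_fourier_apply, one_mul]
      exact f.norm_coe_le_norm t)
  simpa [fourierCoeff] using h

/-- The `k`-th Fourier coefficient as a continuous linear functional. -/
noncomputable def coeffCLM (k : ℤ) : C(Circ, ℂ) →L[ℂ] ℂ :=
  LinearMap.mkContinuous
    { toFun := fun f => fourierCoeff f k
      map_add' := fun f g => by
        rw [ContinuousMap.coe_add, fourierCoeff.add (integrable_haar f) (integrable_haar g)]
        rfl
      map_smul' := fun c f => by
        rw [ContinuousMap.coe_smul, fourierCoeff.const_smul]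
        rfl } 1 (fun f => by simpa using norm_fourierCoeff_le f k)

theorem coeffCLM_apply (k : ℤ) (f : C(Circ, ℂ)) : coeffCLM k f = fourierCoeff f k := rfl

/-- The symmetric partial sum as a continuous linear operator. -/
noncomputable def partialSumCLM (N : ℕ) : C(Circ, ℂ) →L[ℂ] C(Circ, ℂ) :=
  ∑ k ∈ Finset.Icc (-(N : ℤ)) (N : ℤ), (coeffCLM k).smulRight (fourier k)

theorem partialSumCLM_apply (N : ℕ) (f : C(Circ, ℂ)) : partialSumCLM N f = partialSum N f := by
  simp only [partialSumCLM, partialSum, sum_apply,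
    ContinuousLinearMap.smulRight_apply, coeffCLM_apply]

theorem fourier_mul_fourier (a b : ℤ) :
    (fourier a * fourier b : C(Circ, ℂ)) = fourier (a + b) := by
  ext t
  rw [ContinuousMap.mul_apply, fourier_add]

theorem fourierCoeff_fourier_mul (n : ℤ) (f : C(Circ, ℂ)) (k : ℤ) :
    fourierCoeff (fourier n * f : C(Circ, ℂ)) k = fourierCoeff f (k - n) := by
  unfold fourierCoeff
  refine integral_congr_ae (ae_of_all _ fun t => ?_)
  simp only [ContinuousMap.mul_apply, smul_eq_mul]
  rw [← mul_assoc, ← fourier_add]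
  congr 3
  ring

theorem partialSum_fourier (N : ℕ) (k : ℤ) :
    partialSum N (fourier k) = if k.natAbs ≤ N then fourier k else 0 := by
  unfold partialSum
  simp_rw [fourierCoeff_fourier, Pi.single_apply, ite_smul, one_smul, zero_smul]
  rw [Finset.sum_ite_eq']
  congr 1
  rw [Finset.mem_Icc, eq_iff_iff]
  omega

theorem mem_U_iff (f : C(Circ, ℂ)) :
    f ∈ U ↔ Tendsto (fun N => partialSumCLM N f) atTop (𝓝 f) := by
  rw [tendsto_iff_norm_sub_tendsto_zero (b := f)]
  simp only [partialSumCLM_apply, norm_sub_rev _ f]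
  rfl

/-- A series with uniformly dominated partial sums and terms in `U` sums to an element of `U`. -/
theorem hasSum_mem_U {ι : Type*} {F : ι → C(Circ, ℂ)} {g : C(Circ, ℂ)} {b : ι → ℝ}
    (hF : HasSum F g) (hb : Summable b) (hU : ∀ i, F i ∈ U)
    (hFb : ∀ N i, ‖partialSumCLM N (F i)‖ ≤ b i) : g ∈ U := by
  rw [mem_U_iff]
  have h := tendsto_tsum_of_dominated_convergence (𝓕 := atTop)
    (f := fun N i => partialSumCLM N (F i)) (g := F) hb (fun i => (mem_U_iff _).1 (hU i))
    (Eventually.of_forall fun N i => hFb N i)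
  rw [hF.tsum_eq] at h
  refine h.congr fun N => ?_
  exact (hF.mapL (partialSumCLM N)).tsum_eq

theorem exists_bound_of_mem_U {f : C(Circ, ℂ)} (hf : f ∈ U) :
    ∃ M, ∀ N, ‖partialSumCLM N f‖ ≤ M := by
  obtain ⟨M, hM⟩ := ((mem_U_iff f).1 hf).norm.bddAbove_range
  exact ⟨M, fun N => hM ⟨N, rfl⟩⟩

/-- Riemann–Lebesgue, from square summability of the coefficients. -/
theorem tendsto_fourierCoeff_cofinite (f : C(Circ, ℂ)) :
    Tendsto (fun k : ℤ => fourierCoeff f k) cofinite (𝓝 0) := by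
  have h := (hasSum_sq_fourierCoeff
    (ContinuousMap.toLp (E := ℂ) 2 haarAddCircle ℂ f)).summable.tendsto_cofinite_zero
  simp_rw [fourierCoeff_toLp] at h
  rw [tendsto_zero_iff_norm_tendsto_zero]
  have h2 := (Real.continuous_sqrt.tendsto 0).comp h
  simpa [Function.comp_def, Real.sqrt_sq] using h2

/-! ### Exponential sums over blocks of consecutive frequencies -/

theorem fourier_coe_eq_exp (k : ℤ) (x : ℝ) :
    fourier k (x : Circ) = Complex.exp (Complex.I * ((k * x : ℝ) : ℂ)) := by
  rw [fourier_coe_apply]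
  congr 1
  have : (Real.pi : ℂ) ≠ 0 := by exact_mod_cast Real.pi_ne_zero
  push_cast
  field_simp

theorem norm_fourier_sub_one_le (k : ℤ) (x : ℝ) :
    ‖fourier k (x : Circ) - 1‖ ≤ |(k : ℝ)| * |x| := by
  rw [fourier_coe_eq_exp, ← abs_mul]
  exact Real.norm_exp_I_mul_ofReal_sub_one_le

/-- Jordan's inequality for sin applied to |e^{ix} - 1| = 2|sin(x/2)|. -/
theorem le_norm_fourier_one_sub_one {x : ℝ} (hx : |x| ≤ Real.pi) :
    2 / Real.pi * |x| ≤ ‖fourier 1 (x : Circ) - 1‖ := by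
  rw [fourier_coe_eq_exp, Complex.norm_exp_I_mul_ofReal_sub_one]
  have h := Real.mul_le_sin (x := |x| / 2) (by positivity) (by linarith)
  have h2 : Real.sin (|x| / 2) ≤ |Real.sin (x / 2)| := by
    rcases abs_cases x with ⟨hx', _⟩ | ⟨hx', _⟩ <;> rw [hx']
    · exact le_abs_self _
    · rw [neg_div, Real.sin_neg]
      exact neg_le_abs _
  rw [Int.cast_one, one_mul, norm_mul, Real.norm_eq_abs, Real.norm_eq_abs, abs_two]
  linarith

theorem fourier_natCast (k : ℕ) (t : Circ) : fourier (k : ℤ) t = (fourier 1 t) ^ k := by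
  induction k with
  | zero => simp only [Nat.cast_zero, pow_zero, fourier_zero]
  | succ k ih => rw [Nat.cast_succ, fourier_add, ih, pow_succ]

/-- The exponential sum over the `n` consecutive frequencies starting at `a`. -/
theorem norm_sum_fourier_mul_le (a : ℤ) (n : ℕ) {x : ℝ} (hx : |x| ≤ Real.pi) :
    ‖∑ k ∈ Finset.range n, fourier (a + k) (x : Circ)‖ * |x| ≤ Real.pi := by
  set z : ℂ := fourier 1 (x : Circ) with hz
  have h1 : ‖∑ k ∈ Finset.range n, fourier (a + k) (x : Circ)‖ =
      ‖∑ k ∈ Finset.range n, z ^ k‖ := by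
    simp_rw [fourier_add (m := a), ← Finset.mul_sum, norm_mul, norm_fourier_apply, one_mul,
      fourier_natCast]
    rfl
  have h2 : ‖∑ k ∈ Finset.range n, z ^ k‖ * ‖z - 1‖ ≤ 2 := by
    rw [← norm_mul, geom_sum_mul]
    refine (norm_sub_le _ _).trans ?_
    rw [norm_pow, hz, norm_fourier_apply]
    norm_num
  have h3 := le_norm_fourier_one_sub_one hx
  rw [← hz] at h3
  rw [h1]
  have h4 := (mul_le_mul_of_nonneg_left h3 (norm_nonneg (∑ k ∈ Finset.range n, z ^ k))).trans h2
  have hpi := Real.pi_pos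
  have h5 : ‖∑ k ∈ Finset.range n, z ^ k‖ * |x| =
      (‖∑ k ∈ Finset.range n, z ^ k‖ * (2 / Real.pi * |x|)) * (Real.pi / 2) := by
    field_simp
  rw [h5]
  calc _ ≤ 2 * (Real.pi / 2) := by gcongr
    _ = Real.pi := by ring

theorem norm_sum_fourier_le (a : ℤ) (n : ℕ) (t : Circ) :
    ‖∑ k ∈ Finset.range n, fourier (a + k) t‖ ≤ n := by
  refine (norm_sum_le _ _).trans ?_
  simp_rw [norm_fourier_apply]
  simp

theorem exists_real_rep (t : Circ) : ∃ x : ℝ, |x| ≤ Real.pi ∧ (x : Circ) = t := by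
  obtain ⟨x, hx, rfl⟩ : t ∈ ((↑) : ℝ → Circ) '' Set.Icc (-Real.pi) (-Real.pi + 2 * Real.pi) := by
    rw [AddCircle.coe_image_Icc_eq]
    trivial
  exact ⟨x, abs_le.2 ⟨hx.1, by linarith [hx.2]⟩, rfl⟩

/-! ### Logarithmic bound for blocks of a Fourier series -/

theorem integral_inv_add_abs {ε : ℝ} (hε : 0 < ε) :
    ∫ x in (-Real.pi)..Real.pi, (ε + |x|)⁻¹ = 2 * Real.log ((ε + Real.pi) / ε) := by
  have hcont : Continuous fun x : ℝ => (ε + |x|)⁻¹ :=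
    Continuous.inv₀ (by fun_prop) fun x => by positivity
  have hpos : ∫ x in (0 : ℝ)..Real.pi, (ε + |x|)⁻¹ = Real.log ((ε + Real.pi) / ε) := by
    have h1 : ∫ x in (0 : ℝ)..Real.pi, (ε + |x|)⁻¹ = ∫ x in (0 : ℝ)..Real.pi, (ε + x)⁻¹ := by
      refine intervalIntegral.integral_congr fun x hx => ?_
      rw [Set.uIcc_of_le Real.pi_pos.le] at hx
      simp only [abs_of_nonneg hx.1]
    rw [h1, intervalIntegral.integral_comp_add_left (fun x => x⁻¹), add_zero,
      integral_inv_of_pos hε (by positivity)]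
  have hneg : ∫ x in (-Real.pi)..0, (ε + |x|)⁻¹ = ∫ x in (0 : ℝ)..Real.pi, (ε + |x|)⁻¹ := by
    have h := intervalIntegral.integral_comp_neg (a := 0) (b := Real.pi)
      (fun x : ℝ => (ε + |x|)⁻¹)
    simp only [abs_neg, neg_zero] at h
    exact h.symm
  rw [← intervalIntegral.integral_add_adjacent_intervals
    (hcont.intervalIntegrable (-Real.pi) 0) (hcont.intervalIntegrable 0 Real.pi), hneg, hpos]
  ring

/-- The kernel D obeys |D| ≤ n and |D||x| ≤ π. With ε = 1/(n+1) these add up to |D|(ε + |x|) ≤ 1 +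
π, a majorant that integrates to a logarithm. -/
theorem integral_norm_sum_fourier_le (a : ℤ) (n : ℕ) :
    ∫ t, ‖∑ k ∈ Finset.range n, fourier (a + k) t‖ ∂(haarAddCircle (T := 2 * Real.pi)) ≤
      8 * (1 + Real.log (n + 1)) := by
  have hpi := Real.pi_pos
  have hn : (0 : ℝ) < n + 1 := by positivity
  rw [integral_haarAddCircle, ← AddCircle.intervalIntegral_preimage (2 * Real.pi) (-Real.pi),
    show -Real.pi + 2 * Real.pi = Real.pi by ring]
  have h1 : ∫ x in (-Real.pi)..Real.pi, ‖∑ k ∈ Finset.range n, fourier (a + k) (x : Circ)‖ ≤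
      ∫ x in (-Real.pi)..Real.pi, (1 + Real.pi) * (((n : ℝ) + 1)⁻¹ + |x|)⁻¹ := by
    refine intervalIntegral.integral_mono_on (by linarith) ?_ ?_ fun x hx => ?_
    · refine Continuous.intervalIntegrable ?_ _ _
      refine Continuous.norm (continuous_finsetSum _ fun k _ => ?_)
      exact (fourier (T := 2 * Real.pi) (a + k)).continuous.comp (AddCircle.continuous_mk' _)
    · refine Continuous.intervalIntegrable ?_ _ _
      exact continuous_const.mul (Continuous.inv₀ (by fun_prop) fun x => by positivity)
    · rw [← div_eq_mul_inv, le_div_iff₀ (by positivity), mul_add]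
      refine add_le_add ?_ (norm_sum_fourier_mul_le a n (abs_le.2 hx))
      rw [← div_eq_mul_inv, div_le_one hn]
      exact (norm_sum_fourier_le a n _).trans (by linarith)
  rw [intervalIntegral.integral_const_mul, integral_inv_add_abs (by positivity)] at h1
  have h2 : (((n : ℝ) + 1)⁻¹ + Real.pi) / ((n : ℝ) + 1)⁻¹ = 1 + (n + 1) * Real.pi := by
    field_simp
  rw [h2] at h1
  have hpi3 := Real.pi_gt_three
  have hpi4 := Real.pi_lt_four
  have h3 : Real.log (1 + (n + 1) * Real.pi) ≤ 4 + Real.log (n + 1) := by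
    calc Real.log (1 + (n + 1) * Real.pi) ≤ Real.log (5 * (n + 1)) := by
          refine Real.log_le_log (by positivity) ?_
          nlinarith
      _ = Real.log 5 + Real.log (n + 1) := Real.log_mul (by norm_num) hn.ne'
      _ ≤ 4 + Real.log (n + 1) := by
          linarith [Real.log_le_sub_one_of_pos (show (0 : ℝ) < 5 by norm_num)]
  have h4 : 0 ≤ Real.log ((n : ℝ) + 1) := Real.log_nonneg (by linarith [n.cast_nonneg (α := ℝ)])
  have h5 : 0 ≤ Real.log (1 + ((n : ℝ) + 1) * Real.pi) :=
    Real.log_nonneg (by linarith [mul_pos hn hpi])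
  rw [smul_eq_mul, inv_mul_le_iff₀ (by positivity)]
  refine h1.trans ?_
  calc (1 + Real.pi) * (2 * Real.log (1 + (n + 1) * Real.pi))
      ≤ (2 * Real.pi) * (2 * (4 + Real.log (n + 1))) := by gcongr; linarith
    _ ≤ 2 * Real.pi * (8 * (1 + Real.log (n + 1))) :=
        mul_le_mul_of_nonneg_left (by linarith) (by positivity)

/-- The part of the Fourier series of `f` with frequencies in `[a, a + n)`. -/
noncomputable def block (a : ℤ) (n : ℕ) (f : C(Circ, ℂ)) : C(Circ, ℂ) :=
  ∑ k ∈ Finset.range n, fourierCoeff f (a + k) • fourier (a + k)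

theorem block_apply (a : ℤ) (n : ℕ) (f : C(Circ, ℂ)) (t : Circ) :
    block a n f t =
      ∫ s, (∑ k ∈ Finset.range n, fourier (a + k) (t - s)) * f s
        ∂(haarAddCircle (T := 2 * Real.pi)) := by
  simp_rw [Finset.sum_mul]
  rw [integral_finsetSum]
  · simp only [block, ContinuousMap.coe_sum, Finset.sum_apply, ContinuousMap.coe_smul,
      Pi.smul_apply]
    refine Finset.sum_congr rfl fun k _ => ?_
    rw [fourierCoeff, smul_eq_mul, mul_comm, ← integral_const_mul]
    refine integral_congr_ae (ae_of_all _ fun s => ?_)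
    simp only [smul_eq_mul]
    rw [← mul_assoc]
    congr 1
    simp only [fourier_apply, sub_eq_add_neg, smul_add, smul_neg, neg_smul, toCircle_add,
      Circle.coe_mul]
  · intro k _
    refine Continuous.integrable_of_hasCompactSupport ?_ (HasCompactSupport.of_compactSpace _)
    have h : Continuous fun s : Circ => fourier (a + k) (t - s) :=
      (fourier (T := 2 * Real.pi) (a + k)).continuous.comp (continuous_const.sub continuous_id)
    exact h.mul f.continuous

/-- A block is a convolution, so the L¹ norm of its kernel bounds it. -/
theorem norm_block_le (a : ℤ) (n : ℕ) (f : C(Circ, ℂ)) :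
    ‖block a n f‖ ≤ 8 * (1 + Real.log (n + 1)) * ‖f‖ := by
  have h4 : 0 ≤ Real.log ((n : ℝ) + 1) := Real.log_nonneg (by linarith [n.cast_nonneg (α := ℝ)])
  rw [ContinuousMap.norm_le _ (by positivity)]
  intro t
  have hc : Continuous fun s : Circ => ‖∑ k ∈ Finset.range n, fourier (a + k) s‖ :=
    Continuous.norm (continuous_finsetSum _ fun k _ =>
      (fourier (T := 2 * Real.pi) (a + k)).continuous)
  have hc' : Continuous fun s : Circ => ‖∑ k ∈ Finset.range n, fourier (a + k) (t - s)‖ :=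
    hc.comp (continuous_const.sub continuous_id)
  rw [block_apply]
  refine (norm_integral_le_integral_norm _).trans ?_
  calc _ ≤ ∫ s, ‖∑ k ∈ Finset.range n, fourier (a + k) (t - s)‖ * ‖f‖
        ∂(haarAddCircle (T := 2 * Real.pi)) := by
        refine integral_mono_of_nonneg (ae_of_all _ fun s => norm_nonneg _)
          ((hc'.mul continuous_const).integrable_of_hasCompactSupport
            (HasCompactSupport.of_compactSpace _)) (ae_of_all _ fun s => ?_)
        simp only [norm_mul]
        gcongr
        exact f.norm_coe_le_norm s
    _ = (∫ s, ‖∑ k ∈ Finset.range n, fourier (a + k) s‖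
        ∂(haarAddCircle (T := 2 * Real.pi))) * ‖f‖ := by
        rw [integral_mul_const, integral_sub_left_eq_self
          (fun s => ‖∑ k ∈ Finset.range n, fourier (a + k) s‖)]
    _ ≤ _ := by
        gcongr
        exact integral_norm_sum_fourier_le a n

/-- The length is fixed, so Riemann–Lebesgue can be applied term by term. -/
theorem tendsto_block_zero (f : C(Circ, ℂ)) (n : ℕ) {a : ℕ → ℤ}
    (ha : Tendsto a atTop cofinite) : Tendsto (fun N => block (a N) n f) atTop (𝓝 0) := by
  unfold block
  rw [show (0 : C(Circ, ℂ)) = ∑ k ∈ Finset.range n, 0 by simp]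
  refine tendsto_finsetSum _ fun k _ => ?_
  have hk : Tendsto (fun N => a N + (k : ℤ)) atTop cofinite :=
    (add_left_injective (k : ℤ)).tendsto_cofinite.comp ha
  have h := (tendsto_fourierCoeff_cofinite f).comp hk
  rw [tendsto_zero_iff_norm_tendsto_zero] at h ⊢
  simpa only [Function.comp_def, norm_smul, fourier_norm, mul_one] using h

/-! ### Sufficiency: logarithmic weights give multipliers -/

theorem block_add (a : ℤ) (n m : ℕ) (f : C(Circ, ℂ)) :
    block a (n + m) f = block a n f + block (a + n) m f := by
  simp only [block, Finset.sum_range_add, Nat.cast_add, add_assoc]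

theorem sum_Icc_eq_sum_range {M : Type*} [AddCommMonoid M] (u : ℤ → M) (N : ℕ) :
    ∑ k ∈ Finset.Icc (-(N : ℤ)) N, u k = ∑ k ∈ Finset.range (2 * N + 1), u (-N + k) := by
  refine Finset.sum_nbij' (fun k => (k + N).toNat) (fun k => -(N : ℤ) + k) ?_ ?_ ?_ ?_ ?_
  · intro k hk
    rw [Finset.mem_Icc] at hk
    rw [Finset.mem_range]
    omega
  · intro k hk
    rw [Finset.mem_range] at hk
    rw [Finset.mem_Icc]
    omega
  · intro k hk
    rw [Finset.mem_Icc] at hk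
    omega
  · intro k _
    omega
  · intro k hk
    rw [Finset.mem_Icc] at hk
    congr 1
    omega

theorem partialSum_eq_block (N : ℕ) (f : C(Circ, ℂ)) :
    partialSum N f = block (-N) (2 * N + 1) f := by
  rw [partialSum, sum_Icc_eq_sum_range]
  rfl

theorem partialSum_fourier_mul (N : ℕ) (n : ℤ) (f : C(Circ, ℂ)) :
    partialSum N (fourier n * f) = fourier n * block (-N - n) (2 * N + 1) f := by
  rw [partialSum, sum_Icc_eq_sum_range, block, Finset.mul_sum]
  refine Finset.sum_congr rfl fun k _ => ?_
  rw [fourierCoeff_fourier_mul, mul_smul_comm, fourier_mul_fourier]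
  congr 2 <;> ring

/-- Translating a block by `p` exchanges two blocks of length `p`. -/
theorem block_shift (a : ℤ) (p m : ℕ) (f : C(Circ, ℂ)) :
    block (a + p) m f = block a m f + block (a + m) p f - block a p f := by
  rw [← block_add, add_comm m p, block_add, add_sub_cancel_left]

theorem tendsto_cofinite_of_injective {a : ℕ → ℤ} (ha : Function.Injective a) :
    Tendsto a atTop cofinite := by
  rw [← Nat.cofinite_eq_atTop]
  exact ha.tendsto_cofinite

/-- The windows [-N, N] and [-N - n, N - n] differ by a block gained at one end and a block lost at
the other. Their length |n| does not depend on N, and both leave every finite set as N grows. -/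
theorem exists_partialSum_fourier_mul_eq (n : ℤ) :
    ∃ a b : ℕ → ℤ, Tendsto a atTop cofinite ∧ Tendsto b atTop cofinite ∧
      ∀ (N : ℕ) (f : C(Circ, ℂ)), partialSum N (fourier n * f) =
        fourier n * (partialSum N f + block (a N) n.natAbs f - block (b N) n.natAbs f) := by
  obtain ⟨p, rfl | rfl⟩ := n.eq_nat_or_neg
  · refine ⟨fun N => -N - p, fun N => N + 1 - p, tendsto_cofinite_of_injective fun x y h => ?_,
      tendsto_cofinite_of_injective fun x y h => ?_, fun N f => ?_⟩
    · omega
    · omega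
    · have h := block_shift (-N - p) p (2 * N + 1) f
      rw [sub_add_cancel, show (-(N : ℤ) - p + ((2 * N + 1 : ℕ) : ℤ)) = N + 1 - p by
        push_cast; ring] at h
      rw [partialSum_fourier_mul, partialSum_eq_block, h, Int.natAbs_natCast]
      congr 1
      abel
  · refine ⟨fun N => N + 1, fun N => -N, tendsto_cofinite_of_injective fun x y h => ?_,
      tendsto_cofinite_of_injective fun x y h => ?_, fun N f => ?_⟩
    · omega
    · omega
    · have h := block_shift (-N) p (2 * N + 1) f
      rw [show (-(N : ℤ) + ((2 * N + 1 : ℕ) : ℤ)) = N + 1 by push_cast; ring] at h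
      rw [partialSum_fourier_mul, partialSum_eq_block, sub_neg_eq_add, h, Int.natAbs_neg,
        Int.natAbs_natCast]

theorem fourier_mul_mem_U (n : ℤ) {f : C(Circ, ℂ)} (hf : f ∈ U) : fourier n * f ∈ U := by
  obtain ⟨a, b, ha, hb, h⟩ := exists_partialSum_fourier_mul_eq n
  rw [mem_U_iff] at hf ⊢
  simp_rw [partialSumCLM_apply] at hf ⊢
  simp_rw [h]
  simpa using ((hf.add (tendsto_block_zero f n.natAbs ha)).sub
    (tendsto_block_zero f n.natAbs hb)).const_mul (fourier n)

theorem norm_partialSum_fourier_mul_le (n : ℤ) (N : ℕ) (f : C(Circ, ℂ)) :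
    ‖partialSum N (fourier n * f)‖ ≤
      ‖partialSum N f‖ + 16 * (1 + Real.log (n.natAbs + 1)) * ‖f‖ := by
  obtain ⟨a, b, -, -, h⟩ := exists_partialSum_fourier_mul_eq n
  rw [h]
  refine (norm_mul_le _ _).trans ?_
  rw [fourier_norm, one_mul]
  have h1 := norm_block_le (a N) n.natAbs f
  have h2 := norm_block_le (b N) n.natAbs f
  have h3 := norm_sub_le (partialSum N f + block (a N) n.natAbs f) (block (b N) n.natAbs f)
  have h4 := norm_add_le (partialSum N f) (block (a N) n.natAbs f)
  linarith

/-- A continuous function with `∑ |m̂(k)| (1 + log (|k| + 1)) < ∞` is a multiplier. -/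
theorem mem_MU_of_summable {m : C(Circ, ℂ)}
    (hm : Summable fun k : ℤ => ‖fourierCoeff m k‖ * (1 + Real.log (k.natAbs + 1))) :
    m ∈ MU := by
  intro f hf
  have hlog : ∀ k : ℤ, 0 ≤ Real.log ((k.natAbs : ℝ) + 1) := fun k =>
    Real.log_nonneg (by linarith [k.natAbs.cast_nonneg (α := ℝ)])
  have hs : Summable (fourierCoeff m) := by
    refine Summable.of_norm_bounded hm fun k => ?_
    exact le_mul_of_one_le_right (norm_nonneg _) (by linarith [hlog k])
  obtain ⟨M, hM⟩ := exists_bound_of_mem_U hf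
  have hM0 : 0 ≤ M := (norm_nonneg _).trans (hM 0)
  have hF := (hasSum_fourier_series_of_summable hs).mul_right f
  refine hasSum_mem_U hF (hm.mul_left (M + 16 * ‖f‖)) (fun k => ?_) (fun N k => ?_)
  · have h := (mem_U_iff _).1 (fourier_mul_mem_U k hf)
    rw [mem_U_iff]
    simpa only [smul_mul_assoc, map_smul] using h.const_smul (fourierCoeff m k)
  · rw [smul_mul_assoc, map_smul, norm_smul, partialSumCLM_apply]
    have h1 := norm_partialSum_fourier_mul_le k N f
    have h2 := hM N
    rw [partialSumCLM_apply] at h2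
    calc _ ≤ ‖fourierCoeff m k‖ * ((M + 16 * ‖f‖) * (1 + Real.log (k.natAbs + 1))) := by
          gcongr
          have := mul_nonneg hM0 (hlog k)
          linarith
      _ = _ := by ring

theorem exists_log_le_mul {γ : ℕ → ℝ} (hγ : ∃ c : ℝ, 0 < c ∧ ∀ n : ℕ, c ≤ γ n)
    (h : 0 < liminf (fun n : ℕ => ((γ n / Real.log (n : ℝ) : ℝ) : EReal)) atTop) :
    ∃ K : ℝ, ∀ n : ℕ, 1 + Real.log (n + 1) ≤ K * γ n := by
  obtain ⟨δ, hδ, hγδ⟩ := hγ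
  obtain ⟨c, hc0, hc⟩ := EReal.lt_iff_exists_real_btwn.1 h
  have hc0 : 0 < c := by exact_mod_cast hc0
  obtain ⟨n₀, hn₀⟩ := eventually_atTop.1 (eventually_lt_of_lt_liminf hc)
  have hlog0 : 0 ≤ Real.log ((n₀ : ℝ) + 2) :=
    Real.log_nonneg (by linarith [n₀.cast_nonneg (α := ℝ)])
  -- The first term serves n ≥ n₀ + 2, where log n ≥ log 2 > 1/2 gives 1 + log(n+1) ≤ 4 log n; the
  -- second serves the remaining n through γ ≥ δ.
  refine ⟨4 / c + (1 + Real.log (n₀ + 2)) / δ, fun n => ?_⟩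
  have hγn := hγδ n
  have hγ0 : 0 < γ n := hδ.trans_le hγn
  rw [add_mul]
  rcases le_or_gt (n₀ + 2) n with hn | hn
  · have h1 : c < γ n / Real.log n := by exact_mod_cast hn₀ n (by omega)
    have hn2 : (2 : ℝ) ≤ n := by exact_mod_cast (by omega : 2 ≤ n)
    have hlog : Real.log 2 ≤ Real.log n := Real.log_le_log (by norm_num) hn2
    have hl2 := Real.log_two_gt_d9
    rw [lt_div_iff₀ (by linarith)] at h1
    have h2 : Real.log (n + 1) ≤ 2 * Real.log n := by
      rw [← Nat.cast_two, ← Real.log_pow]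
      exact Real.log_le_log (by linarith) (by nlinarith)
    have h3 : Real.log n ≤ γ n / c := by
      rw [le_div_iff₀ hc0]
      linarith
    have h4 : 0 ≤ (1 + Real.log ((n₀ : ℝ) + 2)) / δ * γ n := by positivity
    have h5 : 4 / c * γ n = 4 * (γ n / c) := by ring
    linarith
  · have h1 : Real.log (n + 1) ≤ Real.log (n₀ + 2) := by
      refine Real.log_le_log (by positivity) ?_
      exact_mod_cast (by omega : n + 1 ≤ n₀ + 2)
    have h2 : 1 + Real.log (n₀ + 2) ≤ (1 + Real.log (n₀ + 2)) / δ * γ n := by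
      rw [div_mul_eq_mul_div, le_div_iff₀ hδ]
      gcongr
    have h3 : 0 ≤ 4 / c * γ n := by positivity
    linarith

theorem A_subset_MU_of_liminf_pos {γ : ℕ → ℝ} (hγ : ∃ c : ℝ, 0 < c ∧ ∀ n : ℕ, c ≤ γ n)
    (h : 0 < liminf (fun n : ℕ => ((γ n / Real.log (n : ℝ) : ℝ) : EReal)) atTop) :
    A γ ⊆ MU := by
  obtain ⟨K, hK⟩ := exists_log_le_mul hγ h
  intro m hm
  have hm' : Summable fun k : ℤ => ‖fourierCoeff m k‖ * γ k.natAbs := hm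
  refine mem_MU_of_summable (Summable.of_nonneg_of_le (fun k => ?_) (fun k => ?_) (hm'.mul_left K))
  · have : 0 ≤ Real.log ((k.natAbs : ℝ) + 1) :=
      Real.log_nonneg (by linarith [k.natAbs.cast_nonneg (α := ℝ)])
    positivity
  · calc _ ≤ ‖fourierCoeff m k‖ * (K * γ k.natAbs) := by
          gcongr
          exact hK k.natAbs
      _ = _ := by ring

/-! ### Partial sums of the sawtooth -/

/-- Abel summation; subtracting the boundary term gives an inequality that can be proved by
induction. -/
theorem norm_sum_smul_le_of_antitone {a : ℕ → ℝ} (ha : Antitone a) (ha0 : ∀ k, 0 ≤ a k)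
    {z : ℕ → ℂ} {B : ℝ} (hz : ∀ n, ‖∑ k ∈ Finset.range n, z k‖ ≤ B) (n : ℕ) :
    ‖∑ k ∈ Finset.range n, a k • z k‖ ≤ a 0 * B := by
  have key : ‖∑ k ∈ Finset.range n, a k • z k - a n • ∑ k ∈ Finset.range n, z k‖ ≤
      (a 0 - a n) * B := by
    induction n with
    | zero => simp
    | succ n ih =>
      have h1 : ∑ k ∈ Finset.range (n + 1), a k • z k -
          a (n + 1) • ∑ k ∈ Finset.range (n + 1), z k =
          (∑ k ∈ Finset.range n, a k • z k - a n • ∑ k ∈ Finset.range n, z k) +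
            (a n - a (n + 1)) • ∑ k ∈ Finset.range (n + 1), z k := by
        rw [Finset.sum_range_succ, sub_smul, Finset.sum_range_succ (fun k => z k), smul_add,
          smul_add]
        abel
      have hn : 0 ≤ a n - a (n + 1) := sub_nonneg.2 (ha n.le_succ)
      rw [h1]
      refine (norm_add_le _ _).trans ?_
      rw [norm_smul, Real.norm_of_nonneg hn]
      have h2 := mul_le_mul_of_nonneg_left (hz (n + 1)) hn
      linarith
  have h1 : ‖a n • ∑ k ∈ Finset.range n, z k‖ ≤ a n * B := by
    rw [norm_smul, Real.norm_of_nonneg (ha0 n)]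
    exact mul_le_mul_of_nonneg_left (hz n) (ha0 n)
  have h2 := norm_le_norm_sub_add (∑ k ∈ Finset.range n, a k • z k)
    (a n • ∑ k ∈ Finset.range n, z k)
  linarith

/-- `e^{ikt} - e^{-ikt} = 2i sin kt`. -/
noncomputable def sinMode (k : ℕ) : C(Circ, ℂ) := fourier (k : ℤ) - fourier (-(k : ℤ))

/-- The partial sum `2i ∑_{1 ≤ k ≤ n} sin(kt) / k` of the sawtooth function. -/
noncomputable def sineSum (n : ℕ) : C(Circ, ℂ) :=
  ∑ k ∈ Finset.range n, ((k : ℝ) + 1)⁻¹ • sinMode (k + 1)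

theorem norm_sinMode_le (k : ℕ) (x : ℝ) : ‖sinMode k (x : Circ)‖ ≤ 2 * (k * |x|) := by
  have h1 := norm_fourier_sub_one_le k x
  have h2 := norm_fourier_sub_one_le (-(k : ℤ)) x
  have h3 := norm_sub_le (fourier (k : ℤ) (x : Circ) - 1) (fourier (-(k : ℤ)) (x : Circ) - 1)
  rw [sub_sub_sub_cancel_right] at h3
  rw [Int.cast_neg, abs_neg] at h2
  rw [Int.cast_natCast, Nat.abs_cast] at h1 h2
  rw [sinMode, ContinuousMap.sub_apply]
  linarith

theorem norm_sum_sinMode_le (m n : ℕ) {x : ℝ} (hx : |x| ≤ Real.pi) (hx0 : 0 < |x|) :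
    ‖∑ k ∈ Finset.range n, sinMode (m + k) (x : Circ)‖ ≤ 2 * Real.pi / |x| := by
  have h1 := norm_sum_fourier_mul_le m n hx
  have h2 : ∑ k ∈ Finset.range n, sinMode (m + k) (x : Circ) =
      ∑ k ∈ Finset.range n, fourier (m + k : ℤ) (x : Circ) -
        (starRingEnd ℂ) (∑ k ∈ Finset.range n, fourier (m + k : ℤ) (x : Circ)) := by
    rw [map_sum, ← Finset.sum_sub_distrib]
    refine Finset.sum_congr rfl fun k _ => ?_
    rw [sinMode, ContinuousMap.sub_apply, fourier_neg, Nat.cast_add]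
  rw [h2, le_div_iff₀ hx0]
  have h3 := norm_sub_le (∑ k ∈ Finset.range n, fourier (m + k : ℤ) (x : Circ))
    ((starRingEnd ℂ) (∑ k ∈ Finset.range n, fourier (m + k : ℤ) (x : Circ)))
  rw [RCLike.norm_conj] at h3
  have h4 := mul_le_mul_of_nonneg_right h3 hx0.le
  linarith

theorem norm_sineSum_le (n : ℕ) : ‖sineSum n‖ ≤ 10 := by
  rw [ContinuousMap.norm_le _ (by norm_num)]
  intro t
  obtain ⟨x, hx, rfl⟩ := exists_real_rep t
  have happ : sineSum n (x : Circ) =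
      ∑ k ∈ Finset.range n, ((k : ℝ) + 1)⁻¹ • sinMode (k + 1) (x : Circ) := by
    simp only [sineSum, ContinuousMap.coe_sum, Finset.sum_apply, ContinuousMap.coe_smul,
      Pi.smul_apply]
  have hsmall : ∀ m : ℕ, m * |x| ≤ 1 →
      ‖∑ k ∈ Finset.range m, ((k : ℝ) + 1)⁻¹ • sinMode (k + 1) (x : Circ)‖ ≤ 2 := by
    intro m hm
    have hterm : ∀ k ∈ Finset.range m,
        ‖((k : ℝ) + 1)⁻¹ • sinMode (k + 1) (x : Circ)‖ ≤ 2 * |x| := by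
      intro k _
      have h := norm_sinMode_le (k + 1) x
      have hk : (0 : ℝ) < k + 1 := by positivity
      rw [norm_smul, Real.norm_of_nonneg (by positivity), inv_mul_le_iff₀ hk]
      push_cast at h
      linarith
    refine (norm_sum_le_of_le _ hterm).trans ?_
    rw [Finset.sum_const, Finset.card_range, nsmul_eq_mul]
    linarith
  rw [happ]
  -- The first case includes x = 0.
  rcases le_or_gt (n * |x|) 1 with hn | hn
  · linarith [hsmall n hn]
  have hx0 : 0 < |x| := by
    by_contra h
    have h0 : |x| = 0 := le_antisymm (not_lt.1 h) (abs_nonneg x)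
    rw [h0, mul_zero] at hn
    linarith
  -- Up to K each term is at most 2|x|; beyond K, Abel summation with weights at most 1/(K+1) < |x|
  -- gives 2π.
  set K := ⌊1 / |x|⌋₊ with hK
  have hK1 : K * |x| ≤ 1 := by
    rw [← le_div_iff₀ hx0]
    exact Nat.floor_le (by positivity)
  have hK2 : 1 < (K + 1) * |x| := by
    rw [← div_lt_iff₀ hx0]
    exact Nat.lt_floor_add_one _
  have hKn : K ≤ n := by
    have h : (K : ℝ) < n := lt_of_mul_lt_mul_right (hK1.trans_lt hn) hx0.le
    exact_mod_cast h.le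
  obtain ⟨m, rfl⟩ := Nat.exists_eq_add_of_le hKn
  rw [Finset.sum_range_add]
  have htail : ‖∑ k ∈ Finset.range m,
      (((K + k : ℕ) : ℝ) + 1)⁻¹ • sinMode (K + k + 1) (x : Circ)‖ ≤
      (((K + 0 : ℕ) : ℝ) + 1)⁻¹ * (2 * Real.pi / |x|) := by
    refine norm_sum_smul_le_of_antitone (a := fun k => (((K + k : ℕ) : ℝ) + 1)⁻¹)
      (z := fun k => sinMode (K + k + 1) (x : Circ)) (fun i j hij => ?_)
      (fun k => by positivity) (fun l => ?_) m
    · simp only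
      gcongr
    · have h := norm_sum_sinMode_le (K + 1) l hx hx0
      simpa only [add_right_comm K 1] using h
  have h2 : (((K + 0 : ℕ) : ℝ) + 1)⁻¹ * (2 * Real.pi / |x|) ≤ 2 * Real.pi := by
    have hK0 : (0 : ℝ) < K + 1 := by positivity
    rw [add_zero, inv_mul_le_iff₀ hK0, div_le_iff₀ hx0]
    have := mul_le_mul_of_nonneg_right hK2.le Real.two_pi_pos.le
    linarith
  have h3 := norm_add_le
    (∑ k ∈ Finset.range K, ((k : ℝ) + 1)⁻¹ • sinMode (k + 1) (x : Circ))
    (∑ k ∈ Finset.range m, (((K + k : ℕ) : ℝ) + 1)⁻¹ • sinMode (K + k + 1) (x : Circ))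
  have h4 := hsmall K hK1
  have h5 := Real.pi_lt_four
  linarith

theorem partialSumCLM_sinMode (N k : ℕ) :
    partialSumCLM N (sinMode k) = if k ≤ N then sinMode k else 0 := by
  rw [sinMode, map_sub, partialSumCLM_apply, partialSumCLM_apply, partialSum_fourier,
    partialSum_fourier, Int.natAbs_neg, Int.natAbs_natCast]
  split_ifs
  · rfl
  · rw [sub_zero]

/-- Truncations stay in the family, so `norm_sineSum_le` also bounds every S_N of these functions.
-/
theorem partialSumCLM_sineSum (N n : ℕ) :
    partialSumCLM N (sineSum n) = sineSum (min N n) := by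
  rw [sineSum, map_sum]
  simp_rw [ContinuousLinearMap.map_smul_of_tower, partialSumCLM_sinMode, smul_ite, smul_zero]
  rw [← Finset.sum_filter, sineSum]
  congr 1
  ext k
  simp only [Finset.mem_filter, Finset.mem_range]
  omega

theorem sineSum_mem_U (n : ℕ) : sineSum n ∈ U := by
  rw [mem_U_iff]
  refine tendsto_const_nhds.congr' ?_
  filter_upwards [eventually_ge_atTop n] with N hN
  rw [partialSumCLM_sineSum, min_eq_right hN]

/-! ### Necessity: a lacunary multiplier that destroys uniform convergence -/

/-- The functional `f ↦ -Re S_N(f)(0)`. -/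
noncomputable def negReEval (N : ℕ) : C(Circ, ℂ) →L[ℝ] ℝ :=
  -(Complex.reCLM.comp
    (((ContinuousMap.evalCLM ℂ (0 : Circ)).comp (partialSumCLM N)).restrictScalars ℝ))

theorem negReEval_apply (N : ℕ) (f : C(Circ, ℂ)) :
    negReEval N f = -(partialSumCLM N f 0).re := rfl

theorem abs_negReEval_le (N : ℕ) (f : C(Circ, ℂ)) : |negReEval N f| ≤ ‖partialSumCLM N f‖ := by
  rw [negReEval_apply, abs_neg]
  exact (Complex.abs_re_le_norm _).trans (ContinuousMap.norm_coe_le_norm _ _)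

theorem negReEval_fourier (N : ℕ) (k : ℤ) :
    negReEval N (fourier k) = if k.natAbs ≤ N then -1 else 0 := by
  rw [negReEval_apply, partialSumCLM_apply, partialSum_fourier]
  split_ifs
  · rw [fourier_eval_zero, Complex.one_re]
  · rw [ContinuousMap.zero_apply, Complex.zero_re, neg_zero]

theorem negReEval_fourier_mul_sinMode (N n k : ℕ) :
    negReEval N (fourier n * sinMode k) =
      (if n + k ≤ N then -1 else 0) - (if (n - k : ℤ).natAbs ≤ N then -1 else 0) := by
  rw [sinMode, mul_sub, fourier_mul_fourier, fourier_mul_fourier, map_sub, negReEval_fourier,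
    negReEval_fourier, ← Nat.cast_add, Int.natAbs_natCast, ← sub_eq_add_neg]

/-- If n + k survives the cutoff N then so does n - k. This sign is what rules out cancellation
between cross terms. -/
theorem negReEval_fourier_mul_sinMode_nonneg (N n k : ℕ) :
    0 ≤ negReEval N (fourier n * sinMode k) := by
  rw [negReEval_fourier_mul_sinMode]
  split_ifs
  · norm_num
  · omega
  · norm_num
  · norm_num

theorem negReEval_fourier_mul_sineSum (N n l : ℕ) :
    negReEval N (fourier n * sineSum l) =
      ∑ k ∈ Finset.range l, ((k : ℝ) + 1)⁻¹ * negReEval N (fourier n * sinMode (k + 1)) := by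
  simp_rw [sineSum, Finset.mul_sum, map_sum, mul_smul_comm, map_smul, smul_eq_mul]

theorem negReEval_fourier_mul_sineSum_nonneg (N n l : ℕ) :
    0 ≤ negReEval N (fourier n * sineSum l) := by
  rw [negReEval_fourier_mul_sineSum]
  exact Finset.sum_nonneg fun k _ =>
    mul_nonneg (by positivity) (negReEval_fourier_mul_sinMode_nonneg _ _ _)

/-- At cutoff n all frequencies n + k are lost and all n - k with 1 ≤ k ≤ n are kept. -/
theorem log_le_negReEval_fourier_mul_sineSum {n : ℕ} (hn : 0 < n) :
    Real.log n ≤ negReEval n (fourier n * sineSum n) := by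
  have h1 : negReEval n (fourier n * sineSum n) = ∑ k ∈ Finset.range n, ((k : ℝ) + 1)⁻¹ := by
    rw [negReEval_fourier_mul_sineSum]
    refine Finset.sum_congr rfl fun k hk => ?_
    rw [Finset.mem_range] at hk
    rw [negReEval_fourier_mul_sinMode, if_neg (by omega), if_pos (by omega)]
    ring
  have h2 := log_add_one_le_harmonic n
  rw [harmonic] at h2
  push_cast at h2
  rw [h1]
  refine (Real.log_le_log (by exact_mod_cast hn) ?_).trans h2
  linarith

theorem summable_half_pow : Summable fun j : ℕ => ((1 : ℝ) / 2) ^ j :=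
  summable_geometric_of_lt_one (by norm_num) (by norm_num)

/-- A sum of sawtooth partial sums with summable weights converges in `U`. -/
theorem exists_hasSum_sineSum_mem_U (φ : ℕ → ℕ) :
    ∃ f ∈ U, HasSum (fun j => ((1 : ℝ) / 2) ^ j • sineSum (φ j)) f := by
  have hs : Summable fun j => ((1 : ℝ) / 2) ^ j • sineSum (φ j) := by
    refine Summable.of_norm_bounded (summable_half_pow.mul_right 10) fun j => ?_
    rw [norm_smul, Real.norm_of_nonneg (by positivity)]
    gcongr
    exact norm_sineSum_le _
  refine ⟨_, hasSum_mem_U hs.hasSum (summable_half_pow.mul_right 10) (fun j => ?_)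
    (fun N j => ?_), hs.hasSum⟩
  · have h := (mem_U_iff _).1 (sineSum_mem_U (φ j))
    rw [mem_U_iff]
    simpa only [ContinuousLinearMap.map_smul_of_tower] using h.const_smul (((1 : ℝ) / 2) ^ j)
  · rw [ContinuousLinearMap.map_smul_of_tower, partialSumCLM_sineSum, norm_smul,
      Real.norm_of_nonneg (by positivity)]
    gcongr
    exact norm_sineSum_le _

/-- A lacunary series with weights `2⁻ʲ / γ` belongs to `A γ`. -/
theorem exists_hasSum_fourier_mem_A {γ : ℕ → ℝ} (hγ : ∃ c : ℝ, 0 < c ∧ ∀ n : ℕ, c ≤ γ n)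
    {φ : ℕ → ℕ} (hφ : Function.Injective φ) :
    ∃ m ∈ A γ, HasSum
      (fun j => (((1 : ℝ) / 2) ^ j / γ (φ j)) • (fourier (φ j : ℤ) : C(Circ, ℂ))) m := by
  obtain ⟨δ, hδ, hγδ⟩ := hγ
  have hγ0 : ∀ n, 0 < γ n := fun n => hδ.trans_le (hγδ n)
  have hs : Summable
      fun j => (((1 : ℝ) / 2) ^ j / γ (φ j)) • (fourier (φ j : ℤ) : C(Circ, ℂ)) := by
    refine Summable.of_norm_bounded (summable_half_pow.div_const δ) fun j => ?_
    have := hγ0 (φ j)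
    rw [norm_smul, Real.norm_of_nonneg (by positivity), fourier_norm, mul_one]
    gcongr
    exact hγδ _
  refine ⟨_, ?_, hs.hasSum⟩
  set m := ∑' j, (((1 : ℝ) / 2) ^ j / γ (φ j)) • (fourier (φ j : ℤ) : C(Circ, ℂ)) with hm
  have hcoeff : ∀ k : ℤ, HasSum (fun j => (((1 : ℝ) / 2) ^ j / γ (φ j)) •
      (if k = φ j then (1 : ℂ) else 0)) (fourierCoeff m k) := by
    intro k
    have h := hs.hasSum.mapL ((coeffCLM k).restrictScalars ℝ)
    simpa only [map_smul, ContinuousLinearMap.coe_restrictScalars', coeffCLM_apply,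
      fourierCoeff_fourier, Pi.single_apply] using h
  have hinj : Function.Injective fun j => (φ j : ℤ) := fun i j h => hφ (Nat.cast_injective h)
  change Summable fun k : ℤ => ‖fourierCoeff m k‖ * γ k.natAbs
  -- The coefficients of m vanish off the range of φ, so the weighted sum reduces to ∑ 2⁻ʲ.
  rw [← hinj.summable_iff]
  · refine summable_half_pow.congr fun j => ?_
    have h : fourierCoeff m (φ j) = (((1 : ℝ) / 2) ^ j / γ (φ j)) • (1 : ℂ) := by
      refine (hcoeff (φ j)).unique ?_
      have h := hasSum_single (f := fun i => (((1 : ℝ) / 2) ^ i / γ (φ i)) •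
        (if (φ j : ℤ) = φ i then (1 : ℂ) else 0)) j fun i hi => by
          rw [if_neg fun h => hi (hinj h).symm, smul_zero]
      simpa only [if_true] using h
    have h0 := hγ0 (φ j)
    rw [Function.comp_apply, h, norm_smul, norm_one, mul_one, Int.natAbs_natCast,
      Real.norm_of_nonneg (by positivity), div_mul_cancel₀ _ h0.ne']
  · intro k hk
    have h : fourierCoeff m k = 0 := by
      refine (hcoeff k).unique ?_
      convert! hasSum_zero using 2 with j
      rw [if_neg fun h => hk ⟨j, h.symm⟩, smul_zero]
    rw [h, norm_zero, zero_mul]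

theorem not_A_subset_MU_of_sparse {γ : ℕ → ℝ} (hγ : ∃ c : ℝ, 0 < c ∧ ∀ n : ℕ, c ≤ γ n)
    {φ : ℕ → ℕ} (hφ : Function.Injective φ) (hpos : ∀ j, 0 < φ j)
    (hγφ : ∀ j, γ (φ j) ≤ ((1 : ℝ) / 8) ^ j * Real.log (φ j)) : ¬ A γ ⊆ MU := by
  intro hsub
  obtain ⟨m, hmA, hm⟩ := exists_hasSum_fourier_mem_A hγ hφ
  obtain ⟨f, hfU, hf⟩ := exists_hasSum_sineSum_mem_U φ
  obtain ⟨M, hM⟩ := exists_bound_of_mem_U (hsub hmA f hfU)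
  obtain ⟨δ, hδ, hγδ⟩ := hγ
  have hγ0 : ∀ n, 0 < γ n := fun n => hδ.trans_le (hγδ n)
  have hinner : ∀ N n : ℕ, HasSum
      (fun j => ((1 : ℝ) / 2) ^ j * negReEval N (fourier n * sineSum (φ j)))
      (negReEval N (fourier n * f)) := by
    intro N n
    have h := (hf.mul_left (fourier (n : ℤ))).mapL (negReEval N)
    simpa only [mul_smul_comm, map_smul, smul_eq_mul] using h
  have houter : ∀ N : ℕ, HasSum
      (fun j => (((1 : ℝ) / 2) ^ j / γ (φ j)) * negReEval N (fourier (φ j : ℤ) * f))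
      (negReEval N (m * f)) := by
    intro N
    have h := (hm.mul_right f).mapL (negReEval N)
    simpa only [smul_mul_assoc, map_smul, smul_eq_mul] using h
  have hinner0 : ∀ N n j : ℕ,
      0 ≤ ((1 : ℝ) / 2) ^ j * negReEval N (fourier n * sineSum (φ j)) := fun N n j =>
    mul_nonneg (by positivity) (negReEval_fourier_mul_sineSum_nonneg _ _ _)
  have hlower : ∀ j : ℕ, (2 : ℝ) ^ j ≤ M := by
    intro j
    have h1 := le_hasSum (hinner (φ j) (φ j)) j fun i _ => hinner0 _ _ i
    have h2 := le_hasSum (houter (φ j)) j fun i _ =>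
      mul_nonneg (div_nonneg (by positivity) (hγ0 _).le)
        ((hinner (φ j) (φ i)).nonneg fun l => hinner0 _ _ l)
    have h3 := log_le_negReEval_fourier_mul_sineSum (hpos j)
    have h4 := (le_abs_self _).trans ((abs_negReEval_le (φ j) (m * f)).trans (hM (φ j)))
    have h5 := hγ0 (φ j)
    have h6 : (8 : ℝ) ^ j * γ (φ j) ≤ Real.log (φ j) := by
      have := hγφ j
      rw [one_div, inv_pow] at this
      rwa [← le_inv_mul_iff₀ (by positivity)]
    -- The factor 8ʲ gained from sparsity beats the weights 2⁻ʲ of m and 2⁻ʲ of f.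
    have h7 : ((1 : ℝ) / 2) ^ j * (((1 : ℝ) / 2) ^ j * 8 ^ j) = 2 ^ j := by
      rw [← mul_pow, ← mul_pow]
      norm_num
    calc (2 : ℝ) ^ j = ((1 : ℝ) / 2) ^ j / γ (φ j) * (((1 : ℝ) / 2) ^ j *
          ((8 : ℝ) ^ j * γ (φ j))) := by
          rw [← h7]
          field_simp
      _ ≤ ((1 : ℝ) / 2) ^ j / γ (φ j) * negReEval (φ j) (fourier (φ j : ℤ) * f) := by
          gcongr
          refine le_trans ?_ h1
          gcongr
          exact h6.trans h3
      _ ≤ M := h2.trans h4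
  obtain ⟨j, hj⟩ := pow_unbounded_of_one_lt M (one_lt_two (α := ℝ))
  exact absurd (hlower j) (not_le.2 hj)

theorem exists_sparse_of_liminf_nonpos {γ : ℕ → ℝ}
    (h : ¬ 0 < liminf (fun n : ℕ => ((γ n / Real.log (n : ℝ) : ℝ) : EReal)) atTop) :
    ∃ φ : ℕ → ℕ, StrictMono φ ∧
      ∀ j, 0 < φ j ∧ γ (φ j) ≤ ((1 : ℝ) / 8) ^ j * Real.log (φ j) := by
  refine extraction_forall_of_frequently
    (P := fun j n => 0 < n ∧ γ n ≤ ((1 : ℝ) / 8) ^ j * Real.log n) fun j => ?_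
  have hfreq : ∃ᶠ n : ℕ in atTop, γ n / Real.log n < ((1 : ℝ) / 8) ^ j := by
    intro hev
    have hle : ((((1 : ℝ) / 8) ^ j : ℝ) : EReal) ≤
        liminf (fun n : ℕ => ((γ n / Real.log (n : ℝ) : ℝ) : EReal)) atTop :=
      le_liminf_of_le (by isBoundedDefault)
        (hev.mono fun n hn => EReal.coe_le_coe_iff.2 (not_lt.1 hn))
    exact h (lt_of_lt_of_le (EReal.coe_pos.2 (by positivity)) hle)
  -- Requiring n ≥ 2 makes log n positive, so the quotient can be cleared.
  refine (hfreq.and_eventually (eventually_ge_atTop 2)).mono fun n hn => ⟨by omega, ?_⟩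
  have hlog : 0 < Real.log n := Real.log_pos (by exact_mod_cast hn.2)
  exact ((div_lt_iff₀ hlog).1 hn.1).le

end UnifFourier

theorem corollary1 (γ : ℕ → ℝ) (hγ : ∃ c : ℝ, 0 < c ∧ ∀ n : ℕ, c ≤ γ n) :
    UnifFourier.A γ ⊆ UnifFourier.MU ↔
      0 < Filter.liminf (fun n : ℕ => ((γ n / Real.log (n : ℝ) : ℝ) : EReal)) Filter.atTop := by
  refine ⟨fun h => ?_, UnifFourier.A_subset_MU_of_liminf_pos hγ⟩
  by_contra hlim
  obtain ⟨φ, hφ, hφ'⟩ := UnifFourier.exists_sparse_of_liminf_nonpos hlim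
  exact UnifFourier.not_A_subset_MU_of_sparse hγ hφ.injective (fun j => (hφ' j).1)
    (fun j => (hφ' j).2) h
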